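/- Let $n\ge 5$ and let $\pi=(d_1,d_2,\dots,d_n)$ be a non-increasing sequence of positive integers that is graphic, i.e. the degree sequence of a simple graph of order $n$. Let $K_5-P_3$ denote the graph obtained from the complete graph on five vertices by removing the three edges of a path on four of these vertices. Say that $\pi$ is potentially $K_5-P_3$-graphic if some simple graph with degree sequence $\pi$ contains $K_5-P_3$ as a (not necessarily induced) subgraph. Then $\pi$ is potentially $K_5-P_3$-graphic if and only if the following two conditions hold: (1) $d_1\ge 4$, $d_3\ge 3$ and $d_5\ge 2$; (2) $\pi$ is none of the sequences $(4,3,3,2,2,2)$, $(4,3,3,2,2,2,2)$, $(4,3,3,3,3,3,3)$. -/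

import Mathlib

open Classical in
/-- `IsRealization G d`: the graph `G` on the vertices `0, …, n - 1` realizes the sequence `d`,
i.e. the vertices can be listed so that the `i`-th one has degree `d i`. -/
def IsRealization {n : ℕ} (G : SimpleGraph (Fin n)) (d : Fin n → ℕ) : Prop :=
  ∃ σ : Equiv.Perm (Fin n), ∀ i, G.degree (σ i) = d i

/-- A graphic sequence: a non-increasing sequence of `n` nonnegative integers that is the degree
sequence of a simple graph of order `n`. -/
def IsGraphic {n : ℕ} (d : Fin n → ℕ) : Prop :=
  Antitone d ∧ ∃ G : SimpleGraph (Fin n), IsRealization G d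

/-- `d` has a realization that contains `H` as a (not necessarily induced) subgraph. -/
def PotentiallyGraphic {V : Type*} (H : SimpleGraph V) {n : ℕ} (d : Fin n → ℕ) : Prop :=
  ∃ G : SimpleGraph (Fin n), IsRealization G d ∧ H.IsContained G

/-- The path `P_k` with `k` edges, on `k + 1` vertices. -/
def pathWithEdges (k : ℕ) : SimpleGraph (Fin (k + 1)) :=
  SimpleGraph.pathGraph (k + 1)

/-- The graph `K_5 - P_3`: the complete graph on five vertices with the three edges of a path on
four of these vertices removed. -/
def K5MinusP3 : SimpleGraph (Fin 5) :=
  (⊤ : SimpleGraph (Fin 5)).deleteEdges ((pathWithEdges 3).map Fin.castSuccEmb).edgeSet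

/-! `K5MinusP3` is the gem: a hub joined to every vertex of a path on four vertices, with degrees 4,
3, 3, 2, 2. A sequence realized around a gem must dominate these degrees, which for a sorted
sequence is condition (1) (`dominatesGem_iff`). The exceptional sequences satisfy (1), but their
sums are too small to leave enough edges for the vertices outside a gem (`Potential.le_sum`).

Conversely, induct on `n`, removing a vertex of minimum degree as in Havel–Hakimi. The residual
sequence is again graphic (`exists_hasDegrees_layOffLast`), and a gem in any realization of it
survives when the vertex is put back (`Potential.of_layOffLast`). Two obstacles remain.

The residual may fail to dominate the gem. By `dominatesGem_layOffLast_or` this leaves sequences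
with maximum 4 and at most three fours, and sequences (d, 3, 3, 2, …, 2). The former are small
graphs around a gem plus disjoint copies of K4, K3 and K2, so finitely many residue classes suffice;
the latter arise by hanging triangles on a vertex of large degree.

The residual may be exceptional. Then the sequence has length 7 or 8 and lies in a finite list, each
member of which has an explicit realization (`ofFn_mem_sporadicSequences`,
`potentialMultiset_sporadic`). -/

/-! ### Degree functions, relabelling and multisets of degrees -/

/-- The degree of a vertex, free of decidability instances. -/
noncomputable def natDegreeAt {V : Type*} (G : SimpleGraph V) (v : V) : ℕ :=
  Nat.card {w // G.Adj v w}

theorem natDegreeAt_eq_degree {V : Type*} (G : SimpleGraph V) (v : V)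
    [Fintype (G.neighborSet v)] : natDegreeAt G v = G.degree v := by
  rw [← SimpleGraph.card_neighborSet_eq_degree, ← Nat.card_eq_fintype_card]
  rfl

/-- `G` has the prescribed degree at every vertex. -/
def HasDegrees {V : Type*} (G : SimpleGraph V) (d : V → ℕ) : Prop :=
  ∀ v, natDegreeAt G v = d v

/-- Some graph with degree function `d` contains `K5MinusP3`. -/
def Potential {V : Type*} (d : V → ℕ) : Prop :=
  ∃ G : SimpleGraph V, HasDegrees G d ∧ K5MinusP3.IsContained G

/-- The multiset of values of a function on a finite type. -/
def valueMultiset {V : Type*} [Fintype V] (d : V → ℕ) : Multiset ℕ :=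
  Finset.univ.val.map d

theorem natDegreeAt_map_equiv {V W : Type*} (e : V ≃ W) (G : SimpleGraph V) (v : V) :
    natDegreeAt (G.map e.toEmbedding) (e v) = natDegreeAt G v := by
  refine (Nat.card_congr (e.subtypeEquiv fun a => ?_)).symm
  exact (SimpleGraph.map_adj_apply (f := e.toEmbedding)).symm

theorem HasDegrees.map_equiv {V W : Type*} (e : V ≃ W) {G : SimpleGraph V} {d : V → ℕ}
    {d' : W → ℕ} (hG : HasDegrees G d) (h : ∀ v, d' (e v) = d v) :
    HasDegrees (G.map e.toEmbedding) d' := by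
  intro w
  obtain ⟨v, rfl⟩ := e.surjective w
  rw [natDegreeAt_map_equiv, hG, h]

theorem Potential.map_equiv {V W : Type*} (e : V ≃ W) {d : V → ℕ} {d' : W → ℕ}
    (hd : Potential d) (h : ∀ v, d' (e v) = d v) : Potential d' := by
  obtain ⟨G, hG, hc⟩ := hd
  exact ⟨_, hG.map_equiv e h, hc.trans (SimpleGraph.Iso.map e G).isContained⟩

/-- Over each value the two fibres have the same size, so they can be matched one by one. Hence
being potential depends only on the multiset of degrees. -/
theorem exists_equiv_of_valueMultiset_eq {V W : Type*} [Fintype V] [Fintype W] {d : V → ℕ}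
    {d' : W → ℕ} (h : valueMultiset d = valueMultiset d') : ∃ e : V ≃ W, ∀ v, d' (e v) = d v := by
  classical
  have key : ∀ c, Nonempty ({v // d v = c} ≃ {w // d' w = c}) := by
    intro c
    refine ⟨Fintype.equivOfCardEq ?_⟩
    have := congrArg (Multiset.count c) h
    rw [valueMultiset, valueMultiset, Multiset.count_map, Multiset.count_map] at this
    rw [Fintype.card_subtype, Fintype.card_subtype]
    simpa [Finset.card, Finset.filter, eq_comm] using this
  exact ⟨Equiv.ofFiberEquiv fun c => (key c).some, fun v => Equiv.ofFiberEquiv_map _ v⟩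

theorem valueMultiset_equiv {V W : Type*} [Fintype V] [Fintype W] (e : V ≃ W) {d : V → ℕ}
    {d' : W → ℕ} (h : ∀ v, d' (e v) = d v) : valueMultiset d = valueMultiset d' := by
  have : d = d' ∘ e := funext fun v => (h v).symm
  rw [valueMultiset, valueMultiset, this, ← Multiset.map_map, Multiset.map_univ_val_equiv]

/-- The multiset `M` is the degree multiset of a finite graph that contains `K5MinusP3`. -/
def PotentialMultiset (M : Multiset ℕ) : Prop :=
  ∃ (n : ℕ) (d : Fin n → ℕ), Potential d ∧ valueMultiset d = M

theorem Potential.multiset {V : Type*} [Fintype V] {d : V → ℕ} (h : Potential d) :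
    PotentialMultiset (valueMultiset d) := by
  let e := Fintype.equivFin V
  exact ⟨Fintype.card V, d ∘ e.symm, h.map_equiv e (by simp),
    (valueMultiset_equiv e (by simp)).symm⟩

theorem PotentialMultiset.potential {V : Type*} [Fintype V] {d : V → ℕ}
    (h : PotentialMultiset (valueMultiset d)) : Potential d := by
  obtain ⟨n, d', hd', e⟩ := h
  obtain ⟨σ, hσ⟩ := exists_equiv_of_valueMultiset_eq e
  exact hd'.map_equiv σ hσ

theorem isRealization_iff {n : ℕ} (G : SimpleGraph (Fin n)) (d : Fin n → ℕ) :
    IsRealization G d ↔ ∃ σ : Equiv.Perm (Fin n), ∀ i, natDegreeAt G (σ i) = d i := by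
  unfold IsRealization
  refine exists_congr fun σ => forall_congr' fun i => ?_
  rw [← natDegreeAt_eq_degree]

theorem potentiallyGraphic_iff {n : ℕ} (d : Fin n → ℕ) :
    PotentiallyGraphic K5MinusP3 d ↔ Potential d := by
  constructor
  · rintro ⟨G, hG, hc⟩
    obtain ⟨σ, hσ⟩ := (isRealization_iff G d).1 hG
    exact Potential.map_equiv (d := natDegreeAt G) σ.symm ⟨G, fun _ => rfl, hc⟩
      (fun v => by rw [← hσ, Equiv.apply_symm_apply])
  · rintro ⟨G, hG, hc⟩
    exact ⟨G, (isRealization_iff G d).2 ⟨1, hG⟩, hc⟩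

/-! ### Enlarging a realization -/

/-- The graph on `V ⊕ U` made of `H` on `V`, `K` on `U` and the edges of `R` between them. -/
def joinAlong {V U : Type*} (H : SimpleGraph V) (K : SimpleGraph U) (R : V → U → Prop) :
    SimpleGraph (V ⊕ U) where
  Adj x y := match x, y with
    | .inl v, .inl w => H.Adj v w
    | .inr u, .inr w => K.Adj u w
    | .inl v, .inr u => R v u
    | .inr u, .inl v => R v u
  symm := ⟨fun x y h => by
    cases x <;> cases y <;> first | exact h | exact SimpleGraph.Adj.symm h⟩
  loopless := ⟨fun x h => by cases x <;> exact SimpleGraph.irrefl _ h⟩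

theorem natDegreeAt_joinAlong_inl {V U : Type*} [Finite V] [Finite U] (H : SimpleGraph V)
    (K : SimpleGraph U) (R : V → U → Prop) (v : V) :
    natDegreeAt (joinAlong H K R) (.inl v) = natDegreeAt H v + Nat.card {u // R v u} := by
  rw [natDegreeAt, Nat.card_congr Equiv.subtypeSum, Nat.card_sum]
  rfl

theorem natDegreeAt_joinAlong_inr {V U : Type*} [Finite V] [Finite U] (H : SimpleGraph V)
    (K : SimpleGraph U) (R : V → U → Prop) (u : U) :
    natDegreeAt (joinAlong H K R) (.inr u) = Nat.card {v // R v u} + natDegreeAt K u := by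
  rw [natDegreeAt, Nat.card_congr Equiv.subtypeSum, Nat.card_sum]
  rfl

theorem isContained_joinAlong {V U : Type*} (H : SimpleGraph V) (K : SimpleGraph U)
    (R : V → U → Prop) : H.IsContained (joinAlong H K R) :=
  ⟨⟨⟨Sum.inl, fun h => h⟩, Sum.inl_injective⟩⟩

theorem Potential.joinAlong {V U : Type*} [Finite V] [Finite U] {d : V → ℕ} (hd : Potential d)
    (K : SimpleGraph U) (R : V → U → Prop) {d' : V ⊕ U → ℕ}
    (hl : ∀ v, d' (.inl v) = d v + Nat.card {u // R v u})
    (hr : ∀ u, d' (.inr u) = Nat.card {v // R v u} + natDegreeAt K u) : Potential d' := by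
  obtain ⟨G, hG, hc⟩ := hd
  refine ⟨_, ?_, hc.trans (isContained_joinAlong G K R)⟩
  rintro (v | u)
  · rw [natDegreeAt_joinAlong_inl, hl, hG]
  · rw [natDegreeAt_joinAlong_inr, hr]

theorem valueMultiset_sum {V U : Type*} [Fintype V] [Fintype U] (d : V ⊕ U → ℕ) :
    valueMultiset d = valueMultiset (d ∘ Sum.inl) + valueMultiset (d ∘ Sum.inr) := by
  simp only [valueMultiset]
  rw [← Finset.univ_disjSum_univ, Finset.val_disjSum, Multiset.disjSum, Multiset.map_add,
    Multiset.map_map, Multiset.map_map]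

theorem PotentialMultiset.add {M : Multiset ℕ} (hM : PotentialMultiset M) {U : Type*} [Fintype U]
    (K : SimpleGraph U) : PotentialMultiset (M + valueMultiset (natDegreeAt K)) := by
  obtain ⟨n, d, hd, rfl⟩ := hM
  have := (hd.joinAlong K (fun _ _ => False) (d' := Sum.elim d (natDegreeAt K))
    (by simp) (by simp)).multiset
  rwa [valueMultiset_sum] at this

/-- A triangle is hung on some vertex of degree `x`: two new adjacent vertices, both joined to it.
-/
theorem PotentialMultiset.add_triangle {x : ℕ} {M : Multiset ℕ}
    (hM : PotentialMultiset (x ::ₘ M)) : PotentialMultiset ((x + 2) ::ₘ 2 ::ₘ 2 ::ₘ M) := by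
  classical
  obtain ⟨n, d, hd, h⟩ := hM
  obtain ⟨c, -, hc⟩ := Multiset.mem_map.1 (show x ∈ valueMultiset d by rw [h]; simp)
  have key := (hd.joinAlong (⊤ : SimpleGraph (Fin 2)) (fun v _ => v = c)
    (d' := Sum.elim (Function.update d c (x + 2)) (fun _ => 2)) (by
      intro v
      by_cases hv : v = c <;> simp [hv, hc]) (by
      intro u
      rw [natDegreeAt_eq_degree]
      simp)).multiset
  rw [valueMultiset_sum] at key
  convert key using 1
  have h1 : ∀ f : Fin n → ℕ, valueMultiset f
      = f c ::ₘ (Finset.univ.erase c).val.map f := by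
    intro f
    rw [← Multiset.map_cons f, ← Finset.insert_val_of_notMem (Finset.notMem_erase c _),
      Finset.insert_erase (Finset.mem_univ c)]
    rfl
  rw [Sum.elim_comp_inl, Sum.elim_comp_inr, h1 (Function.update d c (x + 2))]
  rw [h1 d, hc, Multiset.cons_inj_right] at h
  have h2 : (Finset.univ.erase c).val.map (Function.update d c (x + 2)) = M := by
    rw [← h]
    refine Multiset.map_congr rfl fun v hv => ?_
    have : v ≠ c := by
      have : v ∈ Finset.univ.erase c := hv
      simpa using this
    simp [this]
  have h3 : valueMultiset (fun _ : Fin 2 => 2) = 2 ::ₘ 2 ::ₘ 0 := rfl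
  rw [h2, h3]
  simp only [Function.update_self, Multiset.add_cons, add_zero]
  rw [Multiset.cons_swap (x + 2) 2 (2 ::ₘ M), Multiset.cons_swap (x + 2) 2 M]

/-! ### Edge switching and Havel–Hakimi residuals -/

/-- Replace the edges `p q` and `r s` of `G` by `p r` and `q s`. -/
def switchEdges {V : Type*} (G : SimpleGraph V) {p q r s : V} (hpr : p ≠ r) (hqs : q ≠ s) :
    SimpleGraph V where
  Adj x y := (G.Adj x y ∧ s(x, y) ≠ s(p, q) ∧ s(x, y) ≠ s(r, s)) ∨
    s(x, y) = s(p, r) ∨ s(x, y) = s(q, s)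
  symm := ⟨fun x y h => by rwa [Sym2.eq_swap, G.adj_comm]⟩
  loopless := ⟨fun x h => by
    rcases h with h | h | h
    · exact G.irrefl h.1
    · rw [Sym2.eq_iff] at h
      exact h.elim (fun h => hpr (h.1.symm.trans h.2)) fun h => hpr (h.2.symm.trans h.1)
    · rw [Sym2.eq_iff] at h
      exact h.elim (fun h => hqs (h.1.symm.trans h.2)) fun h => hqs (h.2.symm.trans h.1)⟩

/-- Each of the four vertices trades one neighbour for another, so a transposition carries its new
neighbourhood onto the old one; other neighbourhoods do not change. -/
theorem natDegreeAt_switchEdges {V : Type*} (G : SimpleGraph V) {p q r s : V} (hpr : p ≠ r)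
    (hqs : q ≠ s) (hpq : G.Adj p q) (hrs : G.Adj r s) (hpr' : ¬ G.Adj p r) (hqs' : ¬ G.Adj q s)
    (v : V) : natDegreeAt (switchEdges G hpr hqs) v = natDegreeAt G v := by
  classical
  have hpq' := hpq.ne
  have hrs' := hrs.ne
  have hps : p ≠ s := by rintro rfl; exact hpr' hrs.symm
  have hqr : q ≠ r := by rintro rfl; exact hpr' hpq
  have key : ∀ e : V ≃ V, (∀ y, (switchEdges G hpr hqs).Adj v y ↔ G.Adj v (e y)) →
      natDegreeAt (switchEdges G hpr hqs) v = natDegreeAt G v :=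
    fun e he => Nat.card_congr (e.subtypeEquiv he)
  have hsp := hpq.symm
  have hsr := hrs.symm
  have hrp : ¬ G.Adj r p := fun h => hpr' h.symm
  have hsq : ¬ G.Adj s q := fun h => hqs' h.symm
  by_cases hvp : v = p
  · subst hvp
    refine key (Equiv.swap q r) fun y => ?_
    rcases eq_or_ne y q with rfl | h1
    · simp [switchEdges, *, Ne.symm]
    rcases eq_or_ne y r with rfl | h2
    · simp [switchEdges, *]
    rw [Equiv.swap_apply_of_ne_of_ne h1 h2]
    simp [switchEdges, *]
  by_cases hvq : v = q
  · subst hvq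
    refine key (Equiv.swap p s) fun y => ?_
    rcases eq_or_ne y p with rfl | h1
    · simp [switchEdges, *]
    rcases eq_or_ne y s with rfl | h2
    · simp [switchEdges, *]
    rw [Equiv.swap_apply_of_ne_of_ne h1 h2]
    simp [switchEdges, *]
  by_cases hvr : v = r
  · subst hvr
    refine key (Equiv.swap p s) fun y => ?_
    rcases eq_or_ne y p with rfl | h1
    · simp [switchEdges, *]
    rcases eq_or_ne y s with rfl | h2
    · simp [switchEdges, *]
    rw [Equiv.swap_apply_of_ne_of_ne h1 h2]
    simp [switchEdges, *]
  by_cases hvs : v = s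
  · subst hvs
    refine key (Equiv.swap q r) fun y => ?_
    rcases eq_or_ne y q with rfl | h1
    · simp [switchEdges, *]
    rcases eq_or_ne y r with rfl | h2
    · simp [switchEdges, *]
    rw [Equiv.swap_apply_of_ne_of_ne h1 h2]
    simp [switchEdges, *]
  · refine key (Equiv.refl V) fun y => ?_
    simp [switchEdges, *]

/-- Otherwise the neighbours of `u` other than `w` would all be neighbours of `w`, and `l` would
make the degree of `w` strictly larger. The vertex `z` allows the switch of `l w`, `u z` to `l u`,
`w z`. -/
theorem exists_switch_vertex {V : Type*} [Finite V] {G : SimpleGraph V} {l u w : V}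
    (huw : natDegreeAt G w ≤ natDegreeAt G u) (hlw : G.Adj l w) (hlu : ¬ G.Adj l u)
    (hlu' : l ≠ u) : ∃ z, G.Adj u z ∧ z ≠ w ∧ ¬ G.Adj w z := by
  classical
  have := Fintype.ofFinite V
  by_contra! hcon
  rw [natDegreeAt_eq_degree, natDegreeAt_eq_degree] at huw
  have hsub : (G.neighborFinset u).erase w ⊂ (G.neighborFinset w).erase u := by
    rw [Finset.ssubset_iff_of_subset]
    · exact ⟨l, by simp [hlu', hlw.symm], by simp [G.adj_comm u l, hlu]⟩
    · intro z hz
      simp only [Finset.mem_erase, SimpleGraph.mem_neighborFinset] at hz ⊢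
      exact ⟨hz.2.ne', hcon z hz.2 hz.1⟩
  have hlt := Finset.card_lt_card hsub
  by_cases h : G.Adj u w
  · rw [Finset.card_erase_of_mem (by simpa using h), Finset.card_erase_of_mem (by
      simpa using h.symm), SimpleGraph.card_neighborFinset_eq_degree,
      SimpleGraph.card_neighborFinset_eq_degree] at hlt
    omega
  · rw [Finset.erase_eq_of_notMem (by simpa using h), Finset.erase_eq_of_notMem (by
      simpa using fun h' => h h'.symm), SimpleGraph.card_neighborFinset_eq_degree,
      SimpleGraph.card_neighborFinset_eq_degree] at hlt
    omega

theorem mem_iff_lt_card_of_lower {n : ℕ} (S : Finset (Fin n))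
    (hS : ∀ i j, i < j → j ∈ S → i ∈ S) (i : Fin n) : i ∈ S ↔ (i : ℕ) < S.card := by
  constructor
  · intro hi
    have : Finset.Iic i ⊆ S := fun j hj => by
      rcases (Finset.mem_Iic.1 hj).lt_or_eq with h | rfl
      exacts [hS _ _ h hi, hi]
    have := Finset.card_le_card this
    rw [Fin.card_Iic] at this
    omega
  · intro hi
    by_contra hn
    have : S ⊆ Finset.Iio i := fun j hj => by
      rw [Finset.mem_Iio]
      by_contra hji
      rcases (not_lt.1 hji).lt_or_eq with h | rfl
      exacts [hn (hS _ _ h hj), hn hj]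
    have := Finset.card_le_card this
    rw [Fin.card_Iio] at this
    omega

/-- The Havel–Hakimi normalization: in some realization of a non-increasing sequence the last
vertex is joined exactly to the vertices of largest degree. -/
theorem exists_hasDegrees_last {n : ℕ} {d : Fin (n + 1) → ℕ} (hd : Antitone d)
    (h : ∃ G, HasDegrees G d) :
    ∃ G, HasDegrees G d ∧
      ∀ i : Fin n, G.Adj (Fin.last n) i.castSucc ↔ (i : ℕ) < d (Fin.last n) := by
  classical
  -- The weight is the index sum of the neighbours of the last vertex. A switch that trades a
  -- neighbour `w` for a non-neighbour `u < w` lowers it, so at the minimum the neighbours form an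
  -- initial segment.
  let wt : SimpleGraph (Fin (n + 1)) → ℕ := fun G =>
    ∑ i : Fin n, if G.Adj (Fin.last n) i.castSucc then (i : ℕ) else 0
  obtain ⟨G, hG, hmin⟩ := Set.exists_min_image {G | HasDegrees G d} wt (Set.toFinite _) h
  refine ⟨G, hG, ?_⟩
  let S : Finset (Fin n) := {i | G.Adj (Fin.last n) i.castSucc}
  have hcard : S.card = d (Fin.last n) := by
    rw [← hG, natDegreeAt_eq_degree, ← SimpleGraph.card_neighborFinset_eq_degree,
      ← Finset.card_map Fin.castSuccEmb]
    congr 1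
    ext x
    induction x using Fin.lastCases with
    | last => simp [S, Fin.castSucc_ne_last]
    | cast i => simp [S]
  have hlow : ∀ i j, i < j → j ∈ S → i ∈ S := by
    intro u w huw hw
    by_contra hu
    have hw : G.Adj (Fin.last n) w.castSucc := by simpa [S] using hw
    have hu : ¬ G.Adj (Fin.last n) u.castSucc := by simpa [S] using hu
    have hdeg : natDegreeAt G w.castSucc ≤ natDegreeAt G u.castSucc := by
      rw [hG, hG]
      exact hd (Fin.castSucc_le_castSucc_iff.2 huw.le)
    obtain ⟨z, hz, hzw, hwz⟩ := exists_switch_vertex hdeg hw hu (Fin.castSucc_lt_last u).ne'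
    have hlt := hmin (switchEdges G (Fin.castSucc_lt_last u).ne' hzw.symm) fun v => by
      rw [natDegreeAt_switchEdges G (Fin.castSucc_lt_last u).ne' hzw.symm hw hz hu hwz, hG]
    refine absurd hlt (not_le.2 ?_)
    have hzl : z ≠ Fin.last n := by
      rintro rfl
      exact hu hz.symm
    have key : ∀ i : Fin n, (switchEdges G (Fin.castSucc_lt_last u).ne' hzw.symm).Adj
        (Fin.last n) i.castSucc ↔ (G.Adj (Fin.last n) i.castSucc ∧ i ≠ w) ∨ i = u := by
      intro i
      have := (Fin.castSucc_lt_last u).ne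
      have := (Fin.castSucc_lt_last w).ne
      have := (Fin.castSucc_lt_last i).ne
      simp [switchEdges, hzl.symm, *, Ne.symm]
    have hne := huw.ne
    have h1 : ∀ f : Fin n → ℕ, ∑ i, f i
        = f u + (f w + ∑ i ∈ (Finset.univ.erase u).erase w, f i) := by
      intro f
      rw [Finset.add_sum_erase _ _ (by simpa using hne.symm),
        Finset.add_sum_erase _ _ (Finset.mem_univ u)]
    simp only [wt]
    rw [h1, h1 fun i : Fin n => if G.Adj (Fin.last n) i.castSucc then (i : ℕ) else 0]
    have h2 : ∑ i ∈ (Finset.univ.erase u).erase w,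
        (if (switchEdges G (Fin.castSucc_lt_last u).ne' hzw.symm).Adj
          (Fin.last n) i.castSucc then (i : ℕ) else 0) =
        ∑ i ∈ (Finset.univ.erase u).erase w,
          if G.Adj (Fin.last n) i.castSucc then (i : ℕ) else 0 := by
      refine Finset.sum_congr rfl fun i hi => ?_
      simp only [Finset.mem_erase, Finset.mem_univ, and_true] at hi
      have h3 := key i
      simp only [hi.1, hi.2, ne_eq, not_false_eq_true, and_true, or_false] at h3
      simp only [h3]
    rw [h2]
    have hku := (key u).2 (Or.inr rfl)
    have hkw : ¬ (switchEdges G (Fin.castSucc_lt_last u).ne' hzw.symm).Adj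
        (Fin.last n) w.castSucc := by
      rw [key]
      simp [hne.symm]
    rw [if_pos hku, if_neg hkw, if_neg hu, if_pos hw]
    have : (u : ℕ) < w := huw
    omega
  intro i
  rw [← hcard, ← mem_iff_lt_card_of_lower S hlow i]
  simp [S]

/-- The sequence left after the last vertex is removed from the realization of
`exists_hasDegrees_last`. -/
def layOffLast {n : ℕ} (d : Fin (n + 1) → ℕ) (i : Fin n) : ℕ :=
  d i.castSucc - if (i : ℕ) < d (Fin.last n) then 1 else 0

theorem natDegreeAt_comap_add {n : ℕ} (G : SimpleGraph (Fin (n + 1))) (i : Fin n)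
    [Decidable (G.Adj (Fin.last n) i.castSucc)] :
    natDegreeAt (G.comap Fin.castSucc) i + (if G.Adj (Fin.last n) i.castSucc then 1 else 0)
      = natDegreeAt G i.castSucc := by
  classical
  rw [natDegreeAt, natDegreeAt, Nat.card_congr ((finSumFinEquiv (m := n) (n := 1)).symm.subtypeEquiv
    (q := fun x => G.Adj i.castSucc (finSumFinEquiv x)) (by simp)), Nat.card_congr Equiv.subtypeSum,
    Nat.card_sum]
  congr 1
  rw [Nat.card_eq_fintype_card, Fintype.card_subtype]
  split_ifs with h
  · rw [Finset.filter_true_of_mem]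
    · rfl
    · intro x _
      obtain rfl := Subsingleton.elim x 0
      exact h.symm
  · rw [Finset.filter_false_of_mem]
    · rfl
    · intro x _ h'
      obtain rfl := Subsingleton.elim x 0
      exact h h'.symm

theorem exists_hasDegrees_layOffLast {n : ℕ} {d : Fin (n + 1) → ℕ} (hd : Antitone d)
    (h : ∃ G, HasDegrees G d) : ∃ G, HasDegrees G (layOffLast d) := by
  classical
  obtain ⟨G, hG, hl⟩ := exists_hasDegrees_last hd h
  refine ⟨G.comap Fin.castSucc, fun i => ?_⟩
  have := natDegreeAt_comap_add G i
  rw [hG] at this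
  simp only [hl] at this
  rw [layOffLast]
  omega

/-- The removed vertex is joined again to the first `d (Fin.last n)` vertices. Positivity makes the
truncated subtraction in `layOffLast` reversible. -/
theorem Potential.of_layOffLast {n : ℕ} {d : Fin (n + 1) → ℕ}
    (hpos : ∀ i, 1 ≤ d i) (hn : d (Fin.last n) ≤ n)
    (h : Potential (layOffLast d)) : Potential d := by
  have key := h.joinAlong (⊥ : SimpleGraph (Fin 1)) (fun i _ => (i : ℕ) < d (Fin.last n))
    (d' := d ∘ finSumFinEquiv) (by
      intro v
      have h1 := hpos v.castSucc
      change d v.castSucc = _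
      rw [layOffLast]
      split_ifs with h
      · simp [h]
        omega
      · simp [h]) (by
      intro u
      obtain rfl := Subsingleton.elim u 0
      change d (Fin.last n) = _
      rw [natDegreeAt_eq_degree, Nat.card_eq_fintype_card, Fintype.card_subtype,
        Fin.card_filter_val_lt]
      simp [hn])
  exact key.map_equiv finSumFinEquiv (fun _ => rfl)

/-! ### Explicit realizations around a gem -/

theorem K5MinusP3_adj_iff (i j : Fin 5) : K5MinusP3.Adj i j ↔
    s(i, j) ∈ ({s(0, 2), s(0, 3), s(1, 3), s(0, 4), s(1, 4), s(2, 4), s(3, 4)} :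
      Finset (Sym2 (Fin 5))) := by
  have h : K5MinusP3.Adj i j ↔ i ≠ j ∧ ¬ ∃ a b : Fin 4,
      (a.val + 1 = b.val ∨ b.val + 1 = a.val) ∧ a.castSucc = i ∧ b.castSucc = j := by
    rw [K5MinusP3, SimpleGraph.deleteEdges_adj, SimpleGraph.top_adj, SimpleGraph.mem_edgeSet,
      SimpleGraph.map_adj]
    simp only [pathWithEdges, SimpleGraph.pathGraph_adj, Fin.coe_castSuccEmb]
  rw [h]
  clear h
  revert i j
  decide

/-- The graph on `Fin n` with a copy of `K5MinusP3` on the vertices `0, …, 4` and the further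
edges listed in `E`. -/
def extendedGem (n : ℕ) (E : List (ℕ × ℕ)) : SimpleGraph (Fin n) where
  Adj i j := i ≠ j ∧ (((i : ℕ), (j : ℕ)) ∈
      [(0, 1), (0, 2), (0, 3), (0, 4), (1, 2), (1, 3), (2, 4)] ++ E ∨
    ((j : ℕ), (i : ℕ)) ∈ [(0, 1), (0, 2), (0, 3), (0, 4), (1, 2), (1, 3), (2, 4)] ++ E)
  symm := ⟨fun _ _ h => ⟨h.1.symm, h.2.symm⟩⟩
  loopless := ⟨fun _ h => h.1 rfl⟩

instance (n : ℕ) (E : List (ℕ × ℕ)) : DecidableRel (extendedGem n E).Adj :=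
  fun i j => inferInstanceAs (Decidable (i ≠ j ∧ (_ ∨ _)))

theorem isContained_extendedGem {n : ℕ} (hn : 5 ≤ n) (E : List (ℕ × ℕ)) :
    K5MinusP3.IsContained (extendedGem n E) := by
  -- The hub 4 goes to 0, the ends 0 and 3 of the deleted path (degree 3) to 1 and 2, its inner
  -- vertices 1 and 2 (degree 2) to 4 and 3.
  have hinj : Function.Injective (fun i => Fin.castLE hn (![1, 4, 3, 2, 0] i)) :=
    (Fin.castLE_injective hn).comp (by decide)
  refine ⟨⟨⟨fun i => Fin.castLE hn (![1, 4, 3, 2, 0] i), fun {i j} h => ?_⟩, hinj⟩⟩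
  refine ⟨fun hij => h.ne (hinj hij), ?_⟩
  rw [K5MinusP3_adj_iff] at h
  simp only [Fin.val_castLE, List.mem_append]
  have : ∀ i j : Fin 5, s(i, j) ∈ ({s(0, 2), s(0, 3), s(1, 3), s(0, 4), s(1, 4), s(2, 4),
      s(3, 4)} : Finset (Sym2 (Fin 5))) →
      (((![1, 4, 3, 2, 0] i : Fin 5) : ℕ), ((![1, 4, 3, 2, 0] j : Fin 5) : ℕ)) ∈
        [(0, 1), (0, 2), (0, 3), (0, 4), (1, 2), (1, 3), (2, 4)] ∨
      (((![1, 4, 3, 2, 0] j : Fin 5) : ℕ), ((![1, 4, 3, 2, 0] i : Fin 5) : ℕ)) ∈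
        [(0, 1), (0, 2), (0, 3), (0, 4), (1, 2), (1, 3), (2, 4)] := by
    decide
  exact (this i j h).imp Or.inl Or.inl

theorem potentialMultiset_of_edges (L : List ℕ) (E : List (ℕ × ℕ)) (hL : 5 ≤ L.length)
    (h : ∀ i : Fin L.length,
      (Finset.univ.filter fun j => (extendedGem L.length E).Adj i j).card = L.get i) :
    PotentialMultiset L := by
  refine ⟨L.length, L.get, ⟨extendedGem L.length E, fun i => ?_, isContained_extendedGem hL E⟩, ?_⟩
  · rw [natDegreeAt, Nat.card_eq_fintype_card, Fintype.card_subtype, h]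
  · simp [valueMultiset]

/-- The multiset with `k` fours, `a` threes, `b` twos and `c` ones. -/
def smallDegrees (k a b c : ℕ) : Multiset ℕ :=
  Multiset.replicate k 4 + Multiset.replicate a 3 + Multiset.replicate b 2 +
    Multiset.replicate c 1

theorem PotentialMultiset.add_complete {M : Multiset ℕ} (hM : PotentialMultiset M) (m : ℕ) :
    PotentialMultiset (M + Multiset.replicate m (m - 1)) := by
  have h := hM.add (⊤ : SimpleGraph (Fin m))
  have : valueMultiset (natDegreeAt (⊤ : SimpleGraph (Fin m))) = Multiset.replicate m (m - 1) := by
    have : natDegreeAt (⊤ : SimpleGraph (Fin m)) = fun _ => m - 1 := by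
      funext v
      rw [natDegreeAt_eq_degree]
      simp
    simp [valueMultiset, this]
  rwa [this] at h

/-- Disjoint copies of K4, K3 and K2 contribute threes, twos and ones in blocks of 4, 3 and 2. Hence
small representatives of the residue classes modulo 4, 3 and 2 suffice. -/
theorem PotentialMultiset.smallDegrees_add {k a b c : ℕ}
    (h : PotentialMultiset (smallDegrees k a b c)) (p q r : ℕ) :
    PotentialMultiset (smallDegrees k (a + 4 * p) (b + 3 * q) (c + 2 * r)) := by
  induction p with
  | succ p ih =>
    convert ih.add_complete 4 using 1
    simp only [smallDegrees, mul_add, mul_one, ← add_assoc, Multiset.replicate_add]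
    abel
  | zero =>
    induction q with
    | succ q ih =>
      convert ih.add_complete 3 using 1
      simp only [smallDegrees, mul_add, mul_one, ← add_assoc, Multiset.replicate_add]
      abel
    | zero =>
      induction r with
      | succ r ih =>
        convert ih.add_complete 2 using 1
        simp only [smallDegrees, mul_add, mul_one, ← add_assoc, Multiset.replicate_add]
      | zero => exact h

theorem PotentialMultiset.smallDegrees_of_le {k a b c a' b' c' : ℕ}
    (h : PotentialMultiset (smallDegrees k a b c))
    (hle : (a ≤ a' ∧ (a' - a) % 4 = 0) ∧ (b ≤ b' ∧ (b' - b) % 3 = 0) ∧ c ≤ c' ∧ (c' - c) % 2 = 0) :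
    PotentialMultiset (smallDegrees k a' b' c') := by
  convert h.smallDegrees_add ((a' - a) / 4) ((b' - b) / 3) ((c' - c) / 2) using 2 <;> omega

theorem potentialMultiset_smallDegrees_of_edges {k a' b' c' : ℕ} (a b c : ℕ) (L : List ℕ)
    (E : List (ℕ × ℕ)) (hL : 5 ≤ L.length)
    (h : ∀ i : Fin L.length,
      (Finset.univ.filter fun j => (extendedGem L.length E).Adj i j).card = L.get i)
    (hM : (L : Multiset ℕ) = smallDegrees k a b c)
    (hle : (a ≤ a' ∧ (a' - a) % 4 = 0) ∧ (b ≤ b' ∧ (b' - b) % 3 = 0) ∧ c ≤ c' ∧ (c' - c) % 2 = 0) :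
    PotentialMultiset (smallDegrees k a' b' c') :=
  (hM ▸ potentialMultiset_of_edges L E hL h).smallDegrees_of_le hle

/-- An even degree sum forces `a` and `c` to have the same parity; this is the even half. The three
excluded triples are the exceptional sequences, and larger representatives cover the rest of their
residue classes. -/
theorem potentialMultiset_one_four_even {a b c : ℕ} (ha : 2 ≤ a) (hab : 4 ≤ a + b) (hae : a % 2 = 0)
    (hce : c % 2 = 0) (h1 : ¬ (a = 2 ∧ b = 3 ∧ c = 0)) (h2 : ¬ (a = 2 ∧ b = 4 ∧ c = 0))
    (h3 : ¬ (a = 6 ∧ b = 0 ∧ c = 0)) : PotentialMultiset (smallDegrees 1 a b c) := by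
  rcases (by omega : a % 4 = 0 ∨ a = 2 ∨ (6 ≤ a ∧ a % 4 = 2)) with h | h | h
  · rcases (by omega : (0 ≤ b ∧ b % 3 = 0) ∨ (1 ≤ b ∧ b % 3 = 1) ∨ (2 ≤ b ∧ b % 3 = 2))
        with hb | hb | hb
    · exact potentialMultiset_smallDegrees_of_edges 4 0 0 [4, 3, 3, 3, 3]
        [(3, 4)] (by decide) (by decide +kernel) (by decide) (by omega)
    · exact potentialMultiset_smallDegrees_of_edges 4 1 0 [4, 3, 3, 3, 3, 2]
        [(3, 5), (4, 5)] (by decide) (by decide +kernel) (by decide) (by omega)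
    · exact potentialMultiset_smallDegrees_of_edges 4 2 0 [4, 3, 3, 3, 3, 2, 2]
        [(5, 6), (3, 5), (4, 6)] (by decide) (by decide +kernel) (by decide) (by omega)
  -- The gem uses up two twos. The remaining ones form cycles or, if only one or two remain, a path
  -- ending in two ones.
  · rcases (by omega : b % 3 = 2 ∨ (6 ≤ b ∧ b % 3 = 0) ∨ (7 ≤ b ∧ b % 3 = 1) ∨
        (b = 3 ∧ 2 ≤ c) ∨ (b = 4 ∧ 2 ≤ c)) with hb | hb | hb | hb | hb
    · exact potentialMultiset_smallDegrees_of_edges 2 2 0 [4, 3, 3, 2, 2]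
        [] (by decide) (by decide +kernel) (by decide) (by omega)
    · exact potentialMultiset_smallDegrees_of_edges 2 6 0 [4, 3, 3, 2, 2, 2, 2, 2, 2]
        [(5, 6), (5, 7), (6, 8), (7, 8)] (by decide) (by decide +kernel) (by decide) (by omega)
    · exact potentialMultiset_smallDegrees_of_edges 2 7 0 [4, 3, 3, 2, 2, 2, 2, 2, 2, 2]
        [(5, 6), (5, 7), (8, 9), (6, 8), (7, 9)]
        (by decide) (by decide +kernel) (by decide) (by omega)
    · exact potentialMultiset_smallDegrees_of_edges 2 3 2 [4, 3, 3, 2, 2, 2, 1, 1]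
        [(5, 6), (5, 7)] (by decide) (by decide +kernel) (by decide) (by omega)
    · exact potentialMultiset_smallDegrees_of_edges 2 4 2 [4, 3, 3, 2, 2, 2, 2, 1, 1]
        [(5, 6), (5, 7), (6, 8)] (by decide) (by decide +kernel) (by decide) (by omega)
  · rcases (by omega : (b % 3 = 0 ∧ 3 ≤ b) ∨ b % 3 = 1 ∨ b % 3 = 2 ∨
        (b = 0 ∧ 10 ≤ a) ∨ (b = 0 ∧ 2 ≤ c))
      with hb | hb | hb | hb | hb
    · exact potentialMultiset_smallDegrees_of_edges 6 3 0 [4, 3, 3, 3, 3, 3, 3, 2, 2, 2]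
        [(5, 6), (5, 7), (5, 8), (6, 9), (3, 6), (4, 7), (8, 9)]
        (by decide) (by decide +kernel) (by decide) (by omega)
    · exact potentialMultiset_smallDegrees_of_edges 6 1 0 [4, 3, 3, 3, 3, 3, 3, 2]
        [(5, 6), (5, 7), (3, 5), (4, 6), (6, 7)]
        (by decide) (by decide +kernel) (by decide) (by omega)
    · exact potentialMultiset_smallDegrees_of_edges 6 2 0 [4, 3, 3, 3, 3, 3, 3, 2, 2]
        [(5, 6), (5, 7), (5, 8), (3, 6), (4, 6), (7, 8)]
        (by decide) (by decide +kernel) (by decide) (by omega)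
    · exact potentialMultiset_smallDegrees_of_edges 10 0 0 [4, 3, 3, 3, 3, 3, 3, 3, 3, 3, 3]
        [(5, 6), (5, 7), (5, 8), (9, 10), (6, 9), (7, 9), (8, 10), (3, 8), (4, 6), (7, 10)]
        (by decide) (by decide +kernel) (by decide) (by omega)
    · exact potentialMultiset_smallDegrees_of_edges 6 0 2 [4, 3, 3, 3, 3, 3, 3, 1, 1]
        [(5, 6), (3, 5), (4, 5), (6, 7), (6, 8)]
        (by decide) (by decide +kernel) (by decide) (by omega)

theorem potentialMultiset_one_four_odd {a b c : ℕ} (ha : 2 ≤ a) (hab : 4 ≤ a + b) (hao : a % 2 = 1)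
    (hco : c % 2 = 1) : PotentialMultiset (smallDegrees 1 a b c) := by
  rcases (by omega : a % 4 = 1 ∨ (a % 4 = 3 ∧ 1 ≤ b) ∨ (7 ≤ a ∧ a % 4 = 3 ∧ b = 0)) with h | h | h
  · rcases (by omega : (0 ≤ b ∧ b % 3 = 0) ∨ (1 ≤ b ∧ b % 3 = 1) ∨ (2 ≤ b ∧ b % 3 = 2))
        with hb | hb | hb
    · exact potentialMultiset_smallDegrees_of_edges 5 0 1 [4, 3, 3, 3, 3, 3, 1]
        [(3, 5), (4, 5), (5, 6)] (by decide) (by decide +kernel) (by decide) (by omega)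
    · exact potentialMultiset_smallDegrees_of_edges 5 1 1 [4, 3, 3, 3, 3, 3, 2, 1]
        [(5, 6), (3, 5), (4, 5), (6, 7)] (by decide) (by decide +kernel) (by decide) (by omega)
    · exact potentialMultiset_smallDegrees_of_edges 5 2 1 [4, 3, 3, 3, 3, 3, 2, 2, 1]
        [(5, 6), (5, 7), (3, 5), (4, 6), (7, 8)]
        (by decide) (by decide +kernel) (by decide) (by omega)
  · rcases (by omega : (1 ≤ b ∧ b % 3 = 1) ∨ (2 ≤ b ∧ b % 3 = 2) ∨ (3 ≤ b ∧ b % 3 = 0))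
        with hb | hb | hb
    · exact potentialMultiset_smallDegrees_of_edges 3 1 1 [4, 3, 3, 3, 2, 1]
        [(3, 5)] (by decide) (by decide +kernel) (by decide) (by omega)
    · exact potentialMultiset_smallDegrees_of_edges 3 2 1 [4, 3, 3, 3, 2, 2, 1]
        [(3, 5), (5, 6)] (by decide) (by decide +kernel) (by decide) (by omega)
    · exact potentialMultiset_smallDegrees_of_edges 3 3 1 [4, 3, 3, 3, 2, 2, 2, 1]
        [(5, 6), (3, 5), (6, 7)] (by decide) (by decide +kernel) (by decide) (by omega)
  · exact potentialMultiset_smallDegrees_of_edges 7 0 1 [4, 3, 3, 3, 3, 3, 3, 3, 1]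
      [(5, 6), (5, 7), (3, 5), (6, 7), (4, 6), (7, 8)]
      (by decide) (by decide +kernel) (by decide) (by omega)

theorem potentialMultiset_two_fours {a b : ℕ} (ha : 2 ≤ a) (hab : 3 ≤ a + b) (hae : a % 2 = 0) :
    PotentialMultiset (smallDegrees 2 a b 0) := by
  rcases (by omega : a % 4 = 0 ∨ (a % 4 = 2 ∧ 1 ≤ b) ∨ (6 ≤ a ∧ a % 4 = 2 ∧ b = 0)) with h | h | h
  · rcases (by omega : (0 ≤ b ∧ b % 3 = 0) ∨ (1 ≤ b ∧ b % 3 = 1) ∨ (2 ≤ b ∧ b % 3 = 2))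
        with hb | hb | hb
    · exact potentialMultiset_smallDegrees_of_edges 4 0 0 [4, 4, 3, 3, 3, 3]
        [(1, 5), (3, 5), (4, 5)] (by decide) (by decide +kernel) (by decide) (by omega)
    · exact potentialMultiset_smallDegrees_of_edges 4 1 0 [4, 4, 3, 3, 3, 3, 2]
        [(5, 6), (1, 5), (3, 5), (4, 6)] (by decide) (by decide +kernel) (by decide) (by omega)
    · exact potentialMultiset_smallDegrees_of_edges 4 2 0 [4, 4, 3, 3, 3, 3, 2, 2]
        [(5, 6), (5, 7), (1, 5), (3, 4), (6, 7)]
        (by decide) (by decide +kernel) (by decide) (by omega)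
  · rcases (by omega : (1 ≤ b ∧ b % 3 = 1) ∨ (2 ≤ b ∧ b % 3 = 2) ∨ (3 ≤ b ∧ b % 3 = 0))
        with hb | hb | hb
    · exact potentialMultiset_smallDegrees_of_edges 2 1 0 [4, 4, 3, 2, 3]
        [(1, 4)] (by decide) (by decide +kernel) (by decide) (by omega)
    · exact potentialMultiset_smallDegrees_of_edges 2 2 0 [4, 4, 3, 3, 2, 2]
        [(1, 5), (3, 5)] (by decide) (by decide +kernel) (by decide) (by omega)
    · exact potentialMultiset_smallDegrees_of_edges 2 3 0 [4, 4, 3, 3, 2, 2, 2]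
        [(5, 6), (1, 5), (3, 6)] (by decide) (by decide +kernel) (by decide) (by omega)
  · exact potentialMultiset_smallDegrees_of_edges 6 0 0 [4, 4, 3, 3, 3, 3, 3, 3]
      [(5, 6), (5, 7), (1, 5), (6, 7), (3, 6), (4, 7)]
      (by decide) (by decide +kernel) (by decide) (by omega)

theorem potentialMultiset_three_fours {a : ℕ} (ha : 2 ≤ a) (hae : a % 2 = 0) :
    PotentialMultiset (smallDegrees 3 a 0 0) := by
  rcases (by omega : a % 4 = 0 ∨ a % 4 = 2) with h | h
  · exact potentialMultiset_smallDegrees_of_edges 4 0 0 [4, 4, 4, 3, 3, 3, 3]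
      [(5, 6), (1, 5), (2, 5), (3, 6), (4, 6)]
      (by decide) (by decide +kernel) (by decide) (by omega)
  · exact potentialMultiset_smallDegrees_of_edges 2 0 0 [4, 4, 4, 3, 3]
      [(1, 4), (2, 3)] (by decide) (by decide +kernel) (by decide) (by omega)

/-- Induction hangs one triangle at a time, starting from the sequences with a single four. The
exceptions at `m = 0` break the chain for `m = 1` and `b = 5, 6`, which are realized directly. -/
theorem potentialMultiset_friendship {m b : ℕ} (hb : 2 * m + 2 ≤ b)
    (h1 : ¬ (m = 0 ∧ b = 3)) (h2 : ¬ (m = 0 ∧ b = 4)) :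
    PotentialMultiset ((2 * m + 4) ::ₘ 3 ::ₘ 3 ::ₘ Multiset.replicate b 2) := by
  induction m generalizing b with
  | zero =>
    have := potentialMultiset_one_four_even (a := 2) (b := b) (c := 0) (by omega) (by omega)
      (by omega) (by omega) (by omega) (by omega) (by omega)
    convert this using 1
    simp only [smallDegrees, Multiset.replicate_succ, Multiset.replicate_zero, zero_add,
      Multiset.cons_add, mul_zero, add_zero]
  | succ m ih =>
    obtain ⟨b, rfl⟩ : ∃ b', b = b' + 2 := ⟨b - 2, by omega⟩
    by_cases h3 : m = 0 ∧ b = 3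
    · obtain ⟨rfl, rfl⟩ := h3
      exact potentialMultiset_of_edges [6, 3, 3, 2, 2, 2, 2, 2]
        [(0, 5), (0, 6), (5, 7), (6, 7)] (by decide) (by decide +kernel)
    by_cases h4 : m = 0 ∧ b = 4
    · obtain ⟨rfl, rfl⟩ := h4
      exact potentialMultiset_of_edges [6, 3, 3, 2, 2, 2, 2, 2, 2]
        [(0, 5), (0, 6), (7, 8), (5, 7), (6, 8)] (by decide) (by decide +kernel)
    convert (ih (by omega) h3 h4).add_triangle using 1
    simp only [Multiset.replicate_succ]
    rw [show 2 * (m + 1) + 4 = 2 * m + 4 + 2 by ring]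
    rw [Multiset.cons_swap 3 2, Multiset.cons_swap 3 2, Multiset.cons_swap 3 2,
      Multiset.cons_swap 3 2]

/-- Degree sequences treated by an explicit graph. -/
def sporadicSequences : List (List ℕ) :=
  [[4, 4, 4, 4, 4],
    [5, 3, 3, 2, 2, 2, 1],
    [4, 4, 3, 2, 2, 2, 1],
    [5, 4, 3, 2, 2, 2, 2],
    [5, 3, 3, 3, 2, 2, 2],
    [4, 4, 4, 2, 2, 2, 2],
    [5, 3, 3, 2, 2, 2, 2, 1],
    [4, 4, 3, 2, 2, 2, 2, 1],
    [5, 4, 3, 2, 2, 2, 2, 2],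
    [5, 3, 3, 3, 2, 2, 2, 2],
    [4, 4, 4, 2, 2, 2, 2, 2],
    [5, 3, 3, 3, 3, 3, 3, 1],
    [4, 4, 3, 3, 3, 3, 3, 1],
    [5, 4, 3, 3, 3, 3, 3, 2],
    [4, 4, 4, 3, 3, 3, 3, 2],
    [5, 4, 4, 3, 3, 3, 3, 3],
    [4, 4, 4, 4, 3, 3, 3, 3]]

theorem potentialMultiset_sporadic {L : List ℕ} (hL : L ∈ sporadicSequences) :
    PotentialMultiset L := by
  simp only [sporadicSequences, List.mem_cons, List.not_mem_nil, or_false] at hL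
  rcases hL with rfl | rfl | rfl | rfl | rfl | rfl | rfl | rfl | rfl |
    rfl | rfl | rfl | rfl | rfl | rfl | rfl | rfl
  · exact potentialMultiset_of_edges _
      [(3, 4), (2, 3), (1, 4)] (by decide) (by decide +kernel)
  · exact potentialMultiset_of_edges _
      [(0, 5), (5, 6)] (by decide) (by decide +kernel)
  · exact potentialMultiset_of_edges _
      [(1, 5), (5, 6)] (by decide) (by decide +kernel)
  · exact potentialMultiset_of_edges _
      [(5, 6), (0, 5), (1, 6)] (by decide) (by decide +kernel)
  · exact potentialMultiset_of_edges _
      [(5, 6), (0, 5), (3, 6)] (by decide) (by decide +kernel)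
  · exact potentialMultiset_of_edges _
      [(5, 6), (1, 5), (2, 6)] (by decide) (by decide +kernel)
  · exact potentialMultiset_of_edges _
      [(5, 6), (0, 5), (6, 7)] (by decide) (by decide +kernel)
  · exact potentialMultiset_of_edges _
      [(5, 6), (1, 5), (6, 7)] (by decide) (by decide +kernel)
  · exact potentialMultiset_of_edges _
      [(5, 6), (5, 7), (0, 6), (1, 7)] (by decide) (by decide +kernel)
  · exact potentialMultiset_of_edges _
      [(5, 6), (5, 7), (0, 6), (3, 7)] (by decide) (by decide +kernel)
  · exact potentialMultiset_of_edges _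
      [(5, 6), (5, 7), (1, 6), (2, 7)] (by decide) (by decide +kernel)
  · exact potentialMultiset_of_edges _
      [(5, 6), (0, 5), (3, 5), (4, 6), (6, 7)] (by decide) (by decide +kernel)
  · exact potentialMultiset_of_edges _
      [(5, 6), (1, 5), (3, 5), (4, 6), (6, 7)] (by decide) (by decide +kernel)
  · exact potentialMultiset_of_edges _
      [(5, 6), (5, 7), (0, 5), (1, 6), (3, 6), (4, 7)] (by decide) (by decide +kernel)
  · exact potentialMultiset_of_edges _
      [(5, 6), (5, 7), (1, 5), (2, 6), (3, 6), (4, 7)] (by decide) (by decide +kernel)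
  · exact potentialMultiset_of_edges _
      [(5, 6), (5, 7), (0, 5), (6, 7), (1, 6), (2, 3), (4, 7)] (by decide) (by decide +kernel)
  · exact potentialMultiset_of_edges _
      [(5, 6), (5, 7), (3, 5), (6, 7), (1, 6), (2, 3), (4, 7)] (by decide) (by decide +kernel)

/-! ### Necessary conditions: domination and an edge count -/

theorem HasDegrees.lt_card {n : ℕ} {G : SimpleGraph (Fin n)} {d : Fin n → ℕ} (h : HasDegrees G d)
    (i : Fin n) : d i < n := by
  classical
  rw [← h, natDegreeAt_eq_degree]
  simpa using G.degree_lt_card_verts i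

theorem HasDegrees.even_sum {n : ℕ} {G : SimpleGraph (Fin n)} {d : Fin n → ℕ}
    (h : HasDegrees G d) : (valueMultiset d).sum % 2 = 0 := by
  classical
  have h1 : (valueMultiset d).sum = ∑ i, G.degree i :=
    Finset.sum_congr rfl fun i _ => by rw [← h, natDegreeAt_eq_degree]
  rw [h1, G.sum_degrees_eq_twice_card_edges]
  omega

theorem HasDegrees.adj_of_add_one_eq {n : ℕ} {G : SimpleGraph (Fin n)} {d : Fin n → ℕ}
    (h : HasDegrees G d) {i j : Fin n} (hi : d i + 1 = n) (hij : i ≠ j) : G.Adj i j := by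
  classical
  rw [← h, natDegreeAt_eq_degree] at hi
  have hsub : G.neighborFinset i ⊆ Finset.univ.erase i := fun x hx => by
    simpa using (show G.Adj i x by simpa using hx).ne'
  have := Finset.eq_of_subset_of_card_le hsub (by
    rw [Finset.card_erase_of_mem (Finset.mem_univ i), Finset.card_univ, Fintype.card_fin,
      SimpleGraph.card_neighborFinset_eq_degree]
    omega)
  have hj : j ∈ G.neighborFinset i := by
    rw [this]
    simpa using hij.symm
  simpa using hj

/-- `d` dominates the degree sequence of `K5MinusP3` along five distinct vertices. -/
def DominatesGem {V : Type*} (d : V → ℕ) : Prop :=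
  ∃ f : Fin 5 ↪ V, ∀ i, ![4, 3, 3, 2, 2] i ≤ d (f i)

theorem natDegreeAt_K5MinusP3 (i : Fin 5) : natDegreeAt K5MinusP3 i = ![3, 2, 2, 3, 4] i := by
  simp only [natDegreeAt, K5MinusP3_adj_iff, Nat.card_eq_fintype_card]
  revert i
  decide

theorem natDegreeAt_le_of_copy {V W : Type*} [Finite W] {H : SimpleGraph V} {G : SimpleGraph W}
    (f : H.Copy G) (v : V) : natDegreeAt H v ≤ natDegreeAt G (f v) :=
  Nat.card_le_card_of_injective
    (fun w : {w // H.Adj v w} => (⟨f w, f.toHom.map_adj w.2⟩ : {w // G.Adj (f v) w}))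
    fun _ _ h => Subtype.ext (f.injective (congrArg Subtype.val h))

theorem Potential.dominatesGem {V : Type*} [Finite V] {d : V → ℕ} (h : Potential d) :
    DominatesGem d := by
  obtain ⟨G, hG, ⟨f⟩⟩ := h
  refine ⟨⟨fun i => f (![4, 0, 3, 1, 2] i), f.injective.comp (by decide)⟩, fun i => ?_⟩
  have h1 := natDegreeAt_le_of_copy f (![4, 0, 3, 1, 2] i)
  rw [hG, natDegreeAt_K5MinusP3] at h1
  have key : ∀ i : Fin 5, ![4, 3, 3, 2, 2] i = ![3, 2, 2, 3, 4] (![4, 0, 3, 1, 2] i) := by decide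
  exact (key i).trans_le h1

/-- Among `k + 1` distinct positions one is at least `k`. -/
theorem le_apply_of_embedding {n k t : ℕ} {d : Fin n → ℕ} (hd : Antitone d)
    (f : Fin (k + 1) ↪ Fin n) (h : ∀ i, t ≤ d (f i)) (hk : k < n) : t ≤ d ⟨k, hk⟩ := by
  by_contra hcon
  have hlt : ∀ i, (f i : ℕ) < k := fun i => by
    by_contra hi
    exact hcon ((h i).trans (hd (Fin.mk_le_of_le_val (not_lt.1 hi))))
  have := Fintype.card_le_of_injective (fun i => (⟨f i, hlt i⟩ : Fin k)) fun i j hij =>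
    f.injective (Fin.ext (Fin.mk.inj hij))
  simp at this

theorem dominatesGem_iff {n : ℕ} (hn : 4 < n) {d : Fin n → ℕ} (hd : Antitone d) :
    DominatesGem d ↔ 4 ≤ d ⟨0, by omega⟩ ∧ 3 ≤ d ⟨2, by omega⟩ ∧ 2 ≤ d ⟨4, by omega⟩ := by
  constructor
  · rintro ⟨f, hf⟩
    have key : ∀ i : Fin 5, ((i : ℕ) < 1 → 4 ≤ ![4, 3, 3, 2, 2] i) ∧
        ((i : ℕ) < 3 → 3 ≤ ![4, 3, 3, 2, 2] i) ∧ 2 ≤ ![4, 3, 3, 2, 2] i := by decide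
    exact ⟨le_apply_of_embedding hd ((Fin.castLEEmb (by omega : 1 ≤ 5)).trans f)
        (fun i => ((key _).1 i.isLt).trans (hf _)) _,
      le_apply_of_embedding hd ((Fin.castLEEmb (by omega : 3 ≤ 5)).trans f)
        (fun i => ((key _).2.1 i.isLt).trans (hf _)) _,
      le_apply_of_embedding hd f (fun i => (key _).2.2.trans (hf _)) _⟩
  · rintro ⟨h0, h2, h4⟩
    refine ⟨Fin.castLEEmb hn, fun i => ?_⟩
    have h1 : d ⟨2, by omega⟩ ≤ d ⟨1, by omega⟩ := hd (by simp [Fin.le_def])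
    have h3 : d ⟨4, by omega⟩ ≤ d ⟨3, by omega⟩ := hd (by simp [Fin.le_def])
    fin_cases i
    exacts [h0, h2.trans h1, h2, h4.trans h3, h4]

/-- A count of the edges that meet the vertices outside a copy of `K5MinusP3`. -/
theorem Potential.le_sum {V : Type*} [Fintype V] {d : V → ℕ} (h : Potential d) {r m : ℕ}
    (hr : Fintype.card V = 5 + r) (hm : ∀ v, m ≤ d v) :
    14 + 2 * (r * m) ≤ (valueMultiset d).sum + r * (r - 1) := by
  classical
  obtain ⟨G, hG, ⟨f⟩⟩ := h
  let I : Finset V := Finset.univ.map ⟨f, f.injective⟩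
  have hI : Iᶜ.card = r := by
    rw [Finset.card_compl, hr, Finset.card_map, Finset.card_univ, Fintype.card_fin]
    omega
  have hsplit : ∀ v, d v = (I.filter (G.Adj v)).card + (Iᶜ.filter (G.Adj v)).card := by
    intro v
    rw [← hG, natDegreeAt, Nat.card_eq_fintype_card, Fintype.card_subtype,
      ← Finset.card_union_of_disjoint
        (Finset.disjoint_filter_filter disjoint_compl_right), ← Finset.filter_union,
      Finset.union_compl]
  have hin : 14 ≤ ∑ v ∈ I, (I.filter (G.Adj v)).card := by
    rw [Finset.sum_map]
    refine le_trans (Eq.le (?_ : 14 = ∑ i : Fin 5, natDegreeAt K5MinusP3 i))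
      (Finset.sum_le_sum fun i _ => ?_)
    · simp only [natDegreeAt_K5MinusP3]
      decide
    · rw [natDegreeAt, Nat.card_eq_fintype_card, Fintype.card_subtype]
      refine Finset.card_le_card_of_injOn f (fun j hj => ?_) f.injective.injOn
      have hj : K5MinusP3.Adj i j := by simpa using hj
      have := f.toHom.map_adj hj
      simpa [I] using this
  have hcross : ∑ v ∈ I, (Iᶜ.filter (G.Adj v)).card = ∑ v ∈ Iᶜ, (I.filter (G.Adj v)).card := by
    refine (Finset.sum_card_bipartiteAbove_eq_sum_card_bipartiteBelow G.Adj).trans ?_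
    simp only [Finset.bipartiteBelow, G.adj_comm]
  have hout : ∀ v ∈ Iᶜ, (Iᶜ.filter (G.Adj v)).card ≤ r - 1 := by
    intro v hv
    rw [← hI, ← Finset.card_erase_of_mem hv]
    refine Finset.card_le_card fun w hw => ?_
    rw [Finset.mem_filter] at hw
    exact Finset.mem_erase.2 ⟨hw.2.ne', hw.1⟩
  have h1 : (valueMultiset d).sum = ∑ v ∈ I, d v + ∑ v ∈ Iᶜ, d v :=
    (Finset.sum_add_sum_compl I d).symm
  have h2 : ∑ v ∈ I, d v = ∑ v ∈ I, (I.filter (G.Adj v)).card +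
      ∑ v ∈ I, (Iᶜ.filter (G.Adj v)).card := by
    rw [← Finset.sum_add_distrib]
    exact Finset.sum_congr rfl fun v _ => hsplit v
  have h3 : ∑ v ∈ Iᶜ, d v = ∑ v ∈ Iᶜ, (I.filter (G.Adj v)).card +
      ∑ v ∈ Iᶜ, (Iᶜ.filter (G.Adj v)).card := by
    rw [← Finset.sum_add_distrib]
    exact Finset.sum_congr rfl fun v _ => hsplit v
  have h4 : ∑ v ∈ Iᶜ, (Iᶜ.filter (G.Adj v)).card ≤ r * (r - 1) := by
    simpa [hI] using Finset.sum_le_card_nsmul _ _ _ hout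
  have h5 : r * m ≤ ∑ v ∈ Iᶜ, d v := by
    simpa [hI] using Finset.card_nsmul_le_sum Iᶜ d m fun v _ => hm v
  -- The edges between `I` and its complement enter the total twice and the degree sum of the
  -- complement once. So the total is the part inside `I` plus twice the complement's degree sum
  -- minus the part inside the complement.
  omega

/-- The sequences excluded by the characterization. -/
def exceptionalSequences : List (List ℕ) :=
  [[4, 3, 3, 2, 2, 2], [4, 3, 3, 2, 2, 2, 2], [4, 3, 3, 3, 3, 3, 3]]

theorem valueMultiset_eq_ofFn {n : ℕ} (d : Fin n → ℕ) : valueMultiset d = List.ofFn d := by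
  rw [valueMultiset, Fin.univ_val_map]

theorem Potential.ofFn_notMem {n : ℕ} {d : Fin n → ℕ} (h : Potential d) :
    List.ofFn d ∉ exceptionalSequences := by
  intro hmem
  have hlen : (List.ofFn d).length = n := List.length_ofFn
  have key : ∀ r m : ℕ, n = 5 + r → (∀ x ∈ List.ofFn d, m ≤ x) →
      14 + 2 * (r * m) ≤ (List.ofFn d).sum + r * (r - 1) := by
    intro r m hr hm
    have := h.le_sum (m := m) (by rw [Fintype.card_fin, hr]) (fun v => hm _ (by simp))
    rwa [valueMultiset_eq_ofFn] at this
  simp only [exceptionalSequences, List.mem_cons, List.not_mem_nil, or_false] at hmem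
  rcases hmem with hL | hL | hL <;> rw [hL] at hlen key
  · exact absurd (key 1 2 hlen.symm (by decide)) (by decide)
  · exact absurd (key 2 2 hlen.symm (by decide)) (by decide)
  · exact absurd (key 2 3 hlen.symm (by decide)) (by decide)

/-! ### Sorting and counting entries -/

theorem exists_perm_antitone {n : ℕ} (d : Fin n → ℕ) :
    ∃ σ : Equiv.Perm (Fin n), Antitone (d ∘ σ) :=
  ⟨Tuple.sort (fun i => OrderDual.toDual (d i)), fun _ _ h =>
    Tuple.monotone_sort (fun i => OrderDual.toDual (d i)) h⟩

/-- The number of entries that are at least `t`. -/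
def countGE {n : ℕ} (d : Fin n → ℕ) (t : ℕ) : ℕ :=
  (Finset.univ.filter fun i => t ≤ d i).card

/-- Bounds on single entries become linear inequalities between counts, which `omega` can combine
with parity. -/
theorem lt_countGE_iff {n : ℕ} {d : Fin n → ℕ} (hd : Antitone d) (t : ℕ) (i : Fin n) :
    (i : ℕ) < countGE d t ↔ t ≤ d i := by
  rw [countGE, ← mem_iff_lt_card_of_lower]
  · simp
  · intro i j hij hj
    simp only [Finset.mem_filter, Finset.mem_univ, true_and] at hj ⊢
    exact hj.trans (hd hij.le)

theorem countGE_eq_of_forall {n t : ℕ} {d : Fin n → ℕ} (h : ∀ i, t ≤ d i) : countGE d t = n := by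
  rw [countGE, Finset.filter_true_of_mem fun i _ => h i, Finset.card_univ, Fintype.card_fin]

theorem countGE_le {n : ℕ} (d : Fin n → ℕ) (t : ℕ) : countGE d t ≤ n := by
  simpa [countGE] using Finset.card_le_univ (Finset.univ.filter fun i => t ≤ d i)

theorem count_valueMultiset {n : ℕ} (d : Fin n → ℕ) (t : ℕ) :
    (valueMultiset d).count t + countGE d (t + 1) = countGE d t := by
  have h1 : (valueMultiset d).count t = (Finset.univ.filter fun i => d i = t).card := by
    rw [valueMultiset, Multiset.count_map]
    simp [Finset.card, Finset.filter, eq_comm]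
  rw [h1, countGE, countGE, ← Finset.card_union_of_disjoint]
  · congr 1
    ext i
    simp
    omega
  · rw [Finset.disjoint_filter]
    intro i _ h2 h3
    omega

theorem valueMultiset_eq_smallDegrees {n : ℕ} {d : Fin n → ℕ} (hpos : ∀ i, 1 ≤ d i)
    (hle : ∀ i, d i ≤ 4) : valueMultiset d =
      smallDegrees (countGE d 4) (countGE d 3 - countGE d 4) (countGE d 2 - countGE d 3)
        (n - countGE d 2) := by
  have h5 : countGE d 5 = 0 := by
    rw [countGE, Finset.card_eq_zero, Finset.filter_eq_empty_iff]
    intro i _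
    have := hle i
    omega
  have h1 := countGE_eq_of_forall hpos
  ext x
  have h2 : (valueMultiset d).count 1 + countGE d 2 = countGE d 1 := count_valueMultiset d 1
  have h3 : (valueMultiset d).count 2 + countGE d 3 = countGE d 2 := count_valueMultiset d 2
  have h4 : (valueMultiset d).count 3 + countGE d 4 = countGE d 3 := count_valueMultiset d 3
  have h6 : (valueMultiset d).count 4 + countGE d 5 = countGE d 4 := count_valueMultiset d 4
  simp only [smallDegrees, Multiset.count_add, Multiset.count_replicate]
  by_cases hx' : x ∈ Finset.Icc 1 4
  · rw [Finset.mem_Icc] at hx'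
    obtain ⟨hx1, hx2⟩ := hx'
    interval_cases x <;> simp <;> omega
  · have : x ∉ valueMultiset d := by
      intro hmem
      obtain ⟨i, -, rfl⟩ := Multiset.mem_map.1 hmem
      exact hx' (Finset.mem_Icc.2 ⟨hpos i, hle i⟩)
    rw [Multiset.count_eq_zero_of_notMem this]
    rw [Finset.mem_Icc] at hx'
    rw [if_neg, if_neg, if_neg, if_neg] <;> omega

theorem sum_smallDegrees (k a b c : ℕ) :
    (smallDegrees k a b c).sum = 4 * k + 3 * a + 2 * b + c := by
  simp [smallDegrees]
  ring

/-! ### Sequences with an exceptional residual -/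

theorem mem_sporadicSequences_seven : ∀ x0 ∈ List.range 6, ∀ x1 ∈ List.range (x0 + 1),
    ∀ x2 ∈ List.range (x1 + 1), ∀ x3 ∈ List.range (x2 + 1), ∀ x4 ∈ List.range (x3 + 1),
    ∀ x5 ∈ List.range (x4 + 1), ∀ x6 ∈ List.range (x5 + 1), 1 ≤ x6 →
    [x0 - (if 0 < x6 then 1 else 0), x1 - (if 1 < x6 then 1 else 0),
      x2 - (if 2 < x6 then 1 else 0), x3 - (if 3 < x6 then 1 else 0),
      x4 - (if 4 < x6 then 1 else 0), x5 - (if 5 < x6 then 1 else 0)].Perm [4, 3, 3, 2, 2, 2] →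
    [x0, x1, x2, x3, x4, x5, x6] ∈ sporadicSequences := by
  decide +kernel

theorem mem_sporadicSequences_eight : ∀ x0 ∈ List.range 6, ∀ x1 ∈ List.range (x0 + 1),
    ∀ x2 ∈ List.range (x1 + 1), ∀ x3 ∈ List.range (x2 + 1), ∀ x4 ∈ List.range (x3 + 1),
    ∀ x5 ∈ List.range (x4 + 1), ∀ x6 ∈ List.range (x5 + 1), ∀ x7 ∈ List.range (x6 + 1), 1 ≤ x7 →
    ∀ L ∈ [[4, 3, 3, 2, 2, 2, 2], [4, 3, 3, 3, 3, 3, 3]],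
    [x0 - (if 0 < x7 then 1 else 0), x1 - (if 1 < x7 then 1 else 0),
      x2 - (if 2 < x7 then 1 else 0), x3 - (if 3 < x7 then 1 else 0),
      x4 - (if 4 < x7 then 1 else 0), x5 - (if 5 < x7 then 1 else 0),
      x6 - (if 6 < x7 then 1 else 0)].Perm L →
    [x0, x1, x2, x3, x4, x5, x6, x7] ∈ sporadicSequences := by
  decide +kernel

/-- Exceptional entries are at most 4 and laying off lowers an entry by at most one, so `d` has
entries at most 5 and length 7 or 8: a finite search. -/
theorem ofFn_mem_sporadicSequences {n : ℕ} {d : Fin (n + 1) → ℕ} (hd : Antitone d)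
    (hpos : ∀ i, 1 ≤ d i) {L : List ℕ} (hL : L ∈ exceptionalSequences)
    (h : (List.ofFn (layOffLast d)).Perm L) : List.ofFn d ∈ sporadicSequences := by
  have hlen := h.length_eq
  rw [List.length_ofFn] at hlen
  have h4 : ∀ i, layOffLast d i ≤ 4 := fun i => by
    have h1 : layOffLast d i ∈ L := h.subset (by simp)
    have h2 : ∀ L ∈ exceptionalSequences, ∀ x ∈ L, x ≤ 4 := by decide
    exact h2 L hL _ h1
  have h5 : ∀ hn : 0 < n, d 0 ∈ List.range 6 := fun hn => by
    rw [List.mem_range]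
    have := h4 ⟨0, hn⟩
    rw [layOffLast] at this
    change d 0 - _ ≤ 4 at this
    split_ifs at this <;> omega
  have hmem : L = [4, 3, 3, 2, 2, 2] ∨ L ∈ [[4, 3, 3, 2, 2, 2, 2], [4, 3, 3, 3, 3, 3, 3]] := by
    simpa [exceptionalSequences] using hL
  have hs : ∀ i : Fin n, d i.succ ∈ List.range (d i.castSucc + 1) := fun i =>
    List.mem_range.2 (Nat.lt_succ_of_le (hd (Fin.castSucc_le_succ i)))
  rcases hmem with rfl | hmem
  · obtain rfl : n = 6 := hlen
    exact mem_sporadicSequences_seven _ (h5 (by decide)) _ (hs 0) _ (hs 1) _ (hs 2) _ (hs 3) _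
      (hs 4) _ (hs 5) (hpos _) h
  · obtain rfl : n = 7 := by
      simp only [List.mem_cons, List.not_mem_nil, or_false] at hmem
      rcases hmem with rfl | rfl <;> exact hlen
    exact mem_sporadicSequences_eight _ (h5 (by decide)) _ (hs 0) _ (hs 1) _ (hs 2) _ (hs 3) _
      (hs 4) _ (hs 5) _ (hs 6) (hpos _) L hmem h

/-- The exclusions, in terms of the multiset of values. -/
def Exceptional {n : ℕ} (d : Fin n → ℕ) : Prop :=
  ∃ L ∈ exceptionalSequences, (List.ofFn d).Perm L

theorem Exceptional.of_smallDegrees {n k a b c : ℕ} {d : Fin n → ℕ}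
    (h : valueMultiset d = smallDegrees k a b c) {L : List ℕ} (hL : L ∈ exceptionalSequences)
    (hLM : smallDegrees k a b c = L) : Exceptional d := by
  refine ⟨L, hL, Multiset.coe_eq_coe.1 ?_⟩
  rw [← valueMultiset_eq_ofFn, h, hLM]

/-! ### Sequences treated without induction -/

/-- The multiset is given by four counts, and the only consequence of graphicness still needed is
the parity of the degree sum. -/
theorem Potential.of_forall_le_four {n : ℕ} {d : Fin n → ℕ} (hn : 5 ≤ n) (hd : Antitone d)
    (hpos : ∀ i, 1 ≤ d i) (hG : ∃ G, HasDegrees G d) (hdom : DominatesGem d)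
    (hexc : ¬ Exceptional d) (hle : ∀ i, d i ≤ 4)
    (h : countGE d 4 = 1 ∨
      (countGE d 4 = 2 ∧ 3 ≤ countGE d 3 ∧ countGE d 2 = n) ∨
      (countGE d 4 = 3 ∧ 4 ≤ countGE d 3 ∧ countGE d 3 = n)) : Potential d := by
  obtain ⟨G, hG⟩ := hG
  have hsum := hG.even_sum
  obtain ⟨-, h2, h4⟩ := (dominatesGem_iff hn hd).1 hdom
  rw [← lt_countGE_iff hd] at h2 h4
  change 2 < countGE d 3 at h2
  change 4 < countGE d 2 at h4
  have hM := valueMultiset_eq_smallDegrees hpos hle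
  have hmono : countGE d 3 ≤ countGE d 2 := by
    have : _ + countGE d 3 = countGE d 2 := count_valueMultiset d 2
    omega
  have hmono' : countGE d 2 ≤ n := countGE_le d 2
  rw [hM, sum_smallDegrees] at hsum
  refine PotentialMultiset.potential ?_
  rw [hM]
  rcases h with h | h | h
  · rw [h] at hM hsum ⊢
    rcases Nat.mod_two_eq_zero_or_one (n - countGE d 2) with hc | hc
    · refine potentialMultiset_one_four_even (by omega) (by omega) (by omega) hc ?_ ?_ ?_
      · rintro ⟨e1, e2, e3⟩
        rw [e1, e2, e3] at hM
        exact hexc (.of_smallDegrees hM (L := [4, 3, 3, 2, 2, 2]) (by decide) (by decide))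
      · rintro ⟨e1, e2, e3⟩
        rw [e1, e2, e3] at hM
        exact hexc (.of_smallDegrees hM (L := [4, 3, 3, 2, 2, 2, 2]) (by decide) (by decide))
      · rintro ⟨e1, e2, e3⟩
        rw [e1, e2, e3] at hM
        exact hexc (.of_smallDegrees hM (L := [4, 3, 3, 3, 3, 3, 3]) (by decide) (by decide))
    · exact potentialMultiset_one_four_odd (by omega) (by omega) (by omega) hc
  · rw [h.1, h.2.2, Nat.sub_self] at hsum ⊢
    exact potentialMultiset_two_fours (by omega) (by omega) (by omega)
  · rw [h.1, show n - countGE d 2 = 0 by omega, show countGE d 2 - countGE d 3 = 0 by omega]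
      at hsum ⊢
    exact potentialMultiset_three_fours (by omega) (by omega)

theorem Potential.of_fin_five {d : Fin 5 → ℕ} (hd : Antitone d) (hpos : ∀ i, 1 ≤ d i)
    (hG : ∃ G, HasDegrees G d) (hdom : DominatesGem d) (hexc : ¬ Exceptional d) :
    Potential d := by
  have hle : ∀ i, d i ≤ 4 := fun i => by
    obtain ⟨G, hG⟩ := hG
    have := hG.lt_card i
    omega
  obtain ⟨h0, h2, h4⟩ := (dominatesGem_iff (by decide) hd).1 hdom
  have c0 := (lt_countGE_iff hd 4 0).2 h0
  have c2 := (lt_countGE_iff hd 3 2).2 h2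
  have c4 : countGE d 2 = 5 := le_antisymm (countGE_le d 2) ((lt_countGE_iff hd 2 4).2 h4)
  simp only [Fin.coe_ofNat_eq_mod] at c0 c2
  have hmono : countGE d 4 ≤ countGE d 3 := by
    have : _ + countGE d 4 = countGE d 3 := count_valueMultiset d 3
    omega
  have hmono' : countGE d 3 ≤ 5 := countGE_le d 3
  have hM := valueMultiset_eq_smallDegrees hpos hle
  by_cases h5 : countGE d 4 = 5
  · refine PotentialMultiset.potential ?_
    rw [hM, h5, c4, le_antisymm hmono' (h5.symm.trans_le hmono)]
    exact potentialMultiset_sporadic (L := [4, 4, 4, 4, 4]) (by decide)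
  obtain ⟨G, hGd⟩ := id hG
  have hsum := hGd.even_sum
  rw [hM, sum_smallDegrees, c4] at hsum
  -- On five vertices a vertex of degree 4 is adjacent to all others, so three of them force every
  -- degree to be at least 3. Four fours and a three are then excluded by parity.
  have h3 : 3 ≤ countGE d 4 → countGE d 3 = 5 := by
    intro h
    refine le_antisymm hmono' ?_
    have hfull : ∀ i : Fin 5, i ≤ 2 → d i + 1 = 5 := fun i hi => by
      have h1 := (lt_countGE_iff hd 4 i).1 (lt_of_lt_of_le (Nat.lt_succ_of_le hi) h)
      have h2 := hle i
      omega
    have h3 : 3 ≤ d 4 := by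
      classical
      rw [← hGd, natDegreeAt_eq_degree, ← SimpleGraph.card_neighborFinset_eq_degree]
      refine le_trans (by decide) (Finset.card_le_card (s := Finset.Iic (2 : Fin 5)) ?_)
      intro i hi
      rw [Finset.mem_Iic] at hi
      rw [SimpleGraph.mem_neighborFinset]
      refine (hGd.adj_of_add_one_eq (hfull i hi) ?_).symm
      rintro rfl
      exact absurd hi (by decide)
    exact (lt_countGE_iff hd 3 4).2 h3
  refine Potential.of_forall_le_four le_rfl hd hpos hG hdom hexc hle ?_
  omega

theorem Potential.of_one_large_two_threes {n : ℕ} {d : Fin (n + 1) → ℕ} (hn : 5 ≤ n)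
    (hd : Antitone d) (hG : ∃ G, HasDegrees G d) (h0 : 5 ≤ d 0) (h1 : d ⟨1, by omega⟩ = 3)
    (h2 : d ⟨2, by omega⟩ = 3) (h3 : d ⟨3, by omega⟩ = 2) (hl : 2 ≤ d (Fin.last n)) :
    Potential d := by
  obtain ⟨G, hG⟩ := hG
  obtain ⟨r, rfl⟩ : ∃ r, n = r + 2 := ⟨n - 2, by omega⟩
  have hM : valueMultiset d = d 0 ::ₘ 3 ::ₘ 3 ::ₘ Multiset.replicate r 2 := by
    rw [valueMultiset_eq_ofFn, List.ofFn_succ, List.ofFn_succ, List.ofFn_succ]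
    have h4 : (List.ofFn fun i : Fin r => d i.succ.succ.succ) = List.replicate r 2 := by
      rw [← List.ofFn_const]
      congr 1
      funext i
      refine le_antisymm ?_ (hl.trans (hd (Fin.le_last _)))
      rw [← h3]
      exact hd (by simp [Fin.le_def])
    rw [h4]
    change ((d 0 :: d ⟨1, _⟩ :: d ⟨2, _⟩ :: List.replicate r 2 : List ℕ) : Multiset ℕ) = _
    rw [h1, h2]
    rfl
  have hsum := hG.even_sum
  have hlt := hG.lt_card 0
  rw [hM] at hsum
  simp only [Multiset.sum_cons, Multiset.sum_replicate, smul_eq_mul] at hsum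
  refine PotentialMultiset.potential ?_
  rw [hM]
  -- `d 0` is even because the degree sum is, and `d 0 < r + 3` provides the `2 * m + 2` twos
  -- required.
  obtain ⟨m, hm⟩ : ∃ m, d 0 = 2 * m + 4 := ⟨(d 0 - 4) / 2, by omega⟩
  rw [hm]
  exact potentialMultiset_friendship (by omega) (by omega) (by omega)

/-! ### The induction step and the characterization -/

theorem dominatesGem_of_castLE {n : ℕ} (hn : 5 ≤ n) {d : Fin n → ℕ} (σ : Fin 5 → Fin 5)
    (hσ : Function.Injective σ) (h : ∀ i, ![4, 3, 3, 2, 2] i ≤ d (Fin.castLE hn (σ i))) :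
    DominatesGem d :=
  ⟨⟨fun i => Fin.castLE hn (σ i), (Fin.castLE_injective hn).comp hσ⟩, h⟩

/-- Laying off a vertex of minimum degree keeps the degree conditions, except for sequences that
are treated directly. -/
theorem dominatesGem_layOffLast_or {n : ℕ} {d : Fin (n + 1) → ℕ} (hn : 5 ≤ n) (hd : Antitone d)
    (hpos : ∀ i, 1 ≤ d i) (hG : ∃ G, HasDegrees G d) (hdom : DominatesGem d)
    (hexc : ¬ Exceptional d) : DominatesGem (layOffLast d) ∨ Potential d := by
  obtain ⟨h0, h2, h4⟩ := (dominatesGem_iff (by omega) hd).1 hdom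
  have hmin : ∀ i, d (Fin.last n) ≤ d i := fun i => hd (Fin.le_last i)
  have hl := hpos (Fin.last n)
  obtain ⟨x0, e0⟩ : ∃ x, d ⟨0, by omega⟩ = x := ⟨_, rfl⟩
  obtain ⟨x1, e1⟩ : ∃ x, d ⟨1, by omega⟩ = x := ⟨_, rfl⟩
  obtain ⟨x2, e2⟩ : ∃ x, d ⟨2, by omega⟩ = x := ⟨_, rfl⟩
  obtain ⟨x3, e3⟩ : ∃ x, d ⟨3, by omega⟩ = x := ⟨_, rfl⟩
  obtain ⟨x4, e4⟩ : ∃ x, d ⟨4, by omega⟩ = x := ⟨_, rfl⟩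
  have h01 : x1 ≤ x0 := e0 ▸ e1 ▸ hd (by simp)
  have h12 : x2 ≤ x1 := e1 ▸ e2 ▸ hd (by simp [Fin.le_def])
  have h23 : x3 ≤ x2 := e2 ▸ e3 ▸ hd (by simp [Fin.le_def])
  have h34 : x4 ≤ x3 := e3 ▸ e4 ▸ hd (by simp [Fin.le_def])
  have h4l : d (Fin.last n) ≤ x4 := e4 ▸ hmin _
  rw [e0] at h0
  rw [e2] at h2
  rw [e4] at h4
  have f0 : ∀ h, layOffLast d ⟨0, h⟩ = x0 - if 0 < d (Fin.last n) then 1 else 0 :=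
    fun h => e0 ▸ rfl
  have f1 : ∀ h, layOffLast d ⟨1, h⟩ = x1 - if 1 < d (Fin.last n) then 1 else 0 :=
    fun h => e1 ▸ rfl
  have f2 : ∀ h, layOffLast d ⟨2, h⟩ = x2 - if 2 < d (Fin.last n) then 1 else 0 :=
    fun h => e2 ▸ rfl
  have f3 : ∀ h, layOffLast d ⟨3, h⟩ = x3 - if 3 < d (Fin.last n) then 1 else 0 :=
    fun h => e3 ▸ rfl
  have f4 : ∀ h, layOffLast d ⟨4, h⟩ = x4 - if 4 < d (Fin.last n) then 1 else 0 :=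
    fun h => e4 ▸ rfl
  -- The residual need not be sorted, so `σ` says which of the first five positions play the hub,
  -- the two vertices of degree 3 and the two of degree 2.
  have dom : ∀ σ : Fin 5 → Fin 5, Function.Injective σ →
      (∀ i, ![4, 3, 3, 2, 2] i ≤
        ![x0 - if 0 < d (Fin.last n) then 1 else 0, x1 - if 1 < d (Fin.last n) then 1 else 0,
          x2 - if 2 < d (Fin.last n) then 1 else 0, x3 - if 3 < d (Fin.last n) then 1 else 0,
          x4 - if 4 < d (Fin.last n) then 1 else 0] (σ i)) → DominatesGem (layOffLast d) := by
    intro σ hσ h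
    refine dominatesGem_of_castLE hn σ hσ fun i => (h i).trans (Eq.le ?_)
    generalize σ i = j
    fin_cases j
    exacts [(f0 _).symm, (f1 _).symm, (f2 _).symm, (f3 _).symm, (f4 _).symm]
  have hle4 : x0 = 4 → ∀ i, d i ≤ 4 := fun h i => by
    rw [← h, ← e0]
    exact hd (Fin.mk_le_of_le_val (Nat.zero_le _))
  have c0 : 0 < countGE d 4 := (lt_countGE_iff hd 4 ⟨0, by omega⟩).2 (by omega)
  have c1 : 1 < countGE d 4 ↔ 4 ≤ x1 := e1 ▸ lt_countGE_iff hd 4 ⟨1, by omega⟩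
  have c2 : 2 < countGE d 4 ↔ 4 ≤ x2 := e2 ▸ lt_countGE_iff hd 4 ⟨2, by omega⟩
  have c3 : 3 < countGE d 4 ↔ 4 ≤ x3 := e3 ▸ lt_countGE_iff hd 4 ⟨3, by omega⟩
  have c5 : 2 < countGE d 3 := (lt_countGE_iff hd 3 ⟨2, by omega⟩).2 (by omega)
  rcases (by omega : 4 ≤ d (Fin.last n) ∨ d (Fin.last n) = 3 ∨ d (Fin.last n) = 2 ∨
    d (Fin.last n) = 1) with hδ | hδ | hδ | hδ
  · left
    have hge : ∀ i, 3 ≤ layOffLast d i := fun i => by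
      have := hmin i.castSucc
      rw [layOffLast]
      split_ifs <;> omega
    -- Position `n - 1` serves as hub: either it is not lowered, or the minimum degree is at least
    -- `n ≥ 5`.
    have hlast : 4 ≤ layOffLast d ⟨n - 1, by omega⟩ := by
      have := hmin (Fin.castSucc ⟨n - 1, by omega⟩)
      rw [layOffLast]
      split_ifs with h
      · simp only at h
        omega
      · omega
    refine ⟨⟨fun i => if i = 0 then ⟨n - 1, by omega⟩ else ⟨i - 1, by omega⟩, ?_⟩, ?_⟩
    · intro i j hij
      ext
      have hi := i.isLt
      have hj := j.isLt
      by_cases h1 : i = 0 <;> by_cases h2 : j = 0 <;> simp [h1, h2] at hij ⊢ <;> omega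
    · intro i
      by_cases h : i = 0
      · subst h
        exact hlast
      · refine le_trans ?_ (hge _)
        revert h i
        decide
  · rw [hδ] at dom hmin
    by_cases hx0 : 5 ≤ x0
    · exact .inl (dom ![0, 3, 4, 1, 2] (by decide) (by intro i; fin_cases i <;> simp <;> omega))
    by_cases hx3 : 4 ≤ x3
    · exact .inl (dom ![3, 4, 0, 1, 2] (by decide) (by intro i; fin_cases i <;> simp <;> omega))
    -- Now `x0 = 4` and `x3 = 3`: all entries are 3 or 4, with one to three fours.
    right
    have c6 := countGE_eq_of_forall hmin
    have c7 := countGE_eq_of_forall fun i => (hmin i).trans' (by decide : 2 ≤ 3)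
    exact Potential.of_forall_le_four (by omega) hd hpos hG hdom hexc (hle4 (by omega))
      (by omega)
  · rw [hδ] at dom hmin
    by_cases hx0 : 5 ≤ x0
    · by_cases hx3 : 3 ≤ x3
      · exact .inl (dom ![0, 2, 3, 1, 4] (by decide)
          (by intro i; fin_cases i <;> simp <;> omega))
      by_cases hx1 : 4 ≤ x1
      · exact .inl (dom ![0, 1, 2, 3, 4] (by decide)
          (by intro i; fin_cases i <;> simp <;> omega))
      exact .inr (Potential.of_one_large_two_threes hn hd hG (e0.symm ▸ hx0) (by omega)
        (by omega) (by omega) (by omega))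
    by_cases hx2 : 4 ≤ x2
    · exact .inl (dom ![2, 0, 1, 3, 4] (by decide) (by intro i; fin_cases i <;> simp <;> omega))
    right
    have c6 := countGE_eq_of_forall hmin
    exact Potential.of_forall_le_four (by omega) hd hpos hG hdom hexc (hle4 (by omega))
      (by omega)
  · rw [hδ] at dom
    by_cases hx0 : 5 ≤ x0
    · exact .inl (dom ![0, 1, 2, 3, 4] (by decide) (by intro i; fin_cases i <;> simp <;> omega))
    by_cases hx1 : 4 ≤ x1
    · exact .inl (dom ![1, 0, 2, 3, 4] (by decide) (by intro i; fin_cases i <;> simp <;> omega))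
    exact .inr (Potential.of_forall_le_four (by omega) hd hpos hG hdom hexc (hle4 (by omega))
      (by omega))

theorem DominatesGem.comp_perm {n : ℕ} {d : Fin n → ℕ} (h : DominatesGem d)
    (σ : Equiv.Perm (Fin n)) : DominatesGem (d ∘ σ) := by
  obtain ⟨f, hf⟩ := h
  exact ⟨f.trans σ.symm.toEmbedding, fun i => by simpa using hf i⟩

/-- Sortedness is not assumed, since laying off can destroy it; each step sorts anew, and exceptions
are read up to permutation. -/
theorem Potential.of_dominatesGem {n : ℕ} (hn : 5 ≤ n) {d : Fin n → ℕ} (hpos : ∀ i, 1 ≤ d i)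
    (hG : ∃ G, HasDegrees G d) (hdom : DominatesGem d) (hexc : ¬ Exceptional d) :
    Potential d := by
  induction n, hn using Nat.le_induction with
  | base =>
    obtain ⟨σ, hσ⟩ := exists_perm_antitone d
    obtain ⟨G, hG⟩ := hG
    refine Potential.map_equiv σ (d := d ∘ σ) ?_ fun _ => rfl
    refine Potential.of_fin_five hσ (fun i => hpos _) ⟨_, hG.map_equiv σ.symm (by simp)⟩
      (hdom.comp_perm σ) ?_
    rintro ⟨L, hL, hp⟩
    exact hexc ⟨L, hL, (Equiv.Perm.ofFn_comp_perm σ d).symm.trans hp⟩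
  | succ n hn ih =>
    obtain ⟨σ, hσ⟩ := exists_perm_antitone d
    obtain ⟨G, hG⟩ := hG
    refine Potential.map_equiv σ (d := d ∘ σ) ?_ fun _ => rfl
    replace hexc : ¬ Exceptional (d ∘ σ) := by
      rintro ⟨L, hL, hp⟩
      exact hexc ⟨L, hL, (Equiv.Perm.ofFn_comp_perm σ d).symm.trans hp⟩
    replace hG : ∃ G, HasDegrees G (d ∘ σ) := ⟨_, hG.map_equiv σ.symm (by simp)⟩
    replace hpos : ∀ i, 1 ≤ (d ∘ σ) i := fun i => hpos _
    replace hdom := hdom.comp_perm σ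
    generalize d ∘ σ = d at *
    rcases dominatesGem_layOffLast_or hn hσ hpos hG hdom hexc with h | h
    · by_cases hex : Exceptional (layOffLast d)
      · obtain ⟨L, hL, hp⟩ := hex
        refine PotentialMultiset.potential ?_
        rw [valueMultiset_eq_ofFn]
        exact potentialMultiset_sporadic (ofFn_mem_sporadicSequences hσ hpos hL hp)
      · have hlt : d (Fin.last n) ≤ n := by
          obtain ⟨G, hG⟩ := hG
          have := hG.lt_card (Fin.last n)
          omega
        refine Potential.of_layOffLast hpos hlt (ih ?_ (exists_hasDegrees_layOffLast hσ hG) h hex)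
        intro i
        have h0 : 4 ≤ d 0 := ((dominatesGem_iff (by omega) hσ).1 hdom).1
        have hi := hpos i.castSucc
        have hl := hσ (Fin.le_last i.castSucc)
        rw [layOffLast]
        split_ifs with hlt
        -- A lowered position other than 0 requires minimum degree at least 2, and the entry at
        -- position 0 is at least 4; so no entry drops to 0.
        · rcases Nat.eq_zero_or_pos (i : ℕ) with hi0 | hi0
          · have : i.castSucc = 0 := Fin.ext hi0
            rw [this]
            omega
          · omega
        · omega
    · exact h

theorem theorem3p1 (n : ℕ) (hn : 5 ≤ n) (d : Fin n → ℕ) (hd : IsGraphic d)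
    (hpos : ∀ i, 1 ≤ d i) :
    PotentiallyGraphic K5MinusP3 d ↔
      (4 ≤ d ⟨0, by omega⟩ ∧ 3 ≤ d ⟨2, by omega⟩ ∧ 2 ≤ d ⟨4, by omega⟩) ∧
      (List.ofFn d ≠ [4, 3, 3, 2, 2, 2] ∧
        List.ofFn d ≠ [4, 3, 3, 2, 2, 2, 2] ∧
        List.ofFn d ≠ [4, 3, 3, 3, 3, 3, 3]) := by
  obtain ⟨hanti, G, hG⟩ := hd
  obtain ⟨σ, hσ⟩ := (isRealization_iff G d).1 hG
  have hexc : List.ofFn d ∉ exceptionalSequences ↔ List.ofFn d ≠ [4, 3, 3, 2, 2, 2] ∧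
      List.ofFn d ≠ [4, 3, 3, 2, 2, 2, 2] ∧ List.ofFn d ≠ [4, 3, 3, 3, 3, 3, 3] := by
    simp [exceptionalSequences]
  rw [potentiallyGraphic_iff, ← dominatesGem_iff hn hanti, ← hexc]
  refine ⟨fun h => ⟨h.dominatesGem, h.ofFn_notMem⟩, fun ⟨hdom, hne⟩ => ?_⟩
  refine Potential.of_dominatesGem hn hpos
    ⟨_, HasDegrees.map_equiv (d := natDegreeAt G) σ.symm (fun _ => rfl)
      fun v => by rw [← hσ, Equiv.apply_symm_apply]⟩ hdom ?_
  rintro ⟨L, hL, hp⟩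
  have hs : ∀ L ∈ exceptionalSequences, L.SortedGE := by decide
  exact hne (hp.eq_of_sortedGE hanti.sortedGE_ofFn (hs L hL) ▸ hL)
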